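/- Let $\mathbb{K}\in\{\mathbb{R},\mathbb{C}\}$, let $m\ge 2$ be an integer and let $q_1,\dots,q_m\in[1,2]$ satisfy $$\frac1{q_1}+\cdots+\frac1{q_m}=\frac{m+1}{2}\qquad\text{and}\qquad \max_i q_i<\frac{2m^2-4m+2}{m^2-m-1}.$$ Let $B^{\mathbb{K}}_{m,(q_1,\dots,q_m)}$ be the optimal constant of the generalized Bohnenblust–Hille inequality, that is, the infimum of all $C\ge 1$ such that $$\Bigl(\sum_{j_1=1}^n\cdots\Bigl(\sum_{j_m=1}^n|T(e_{j_1},\dots,e_{j_m})|^{q_m}\Bigr)^{\frac{q_{m-1}}{q_m}}\cdots\Bigr)^{\frac1{q_1}}\le C\,\|T\|$$ for all positive integers $n$ and all $m$-linear forms $T:\ell_\infty^n\times\cdots\times\ell_\infty^n\to\mathbb{K}$, where $e_1,\dots,e_n$ are the canonical unit vectors of $\mathbb{K}^n$ and $\|T\|$ is the supremum of $|T|$ on the product of the closed unit balls. For $q\in[1,2]$ let $A_q$ be the best constant of the Khinchine inequality for the scalar field $\mathbb{K}$. That is, if $\mathbb{K}=\mathbb{R}$, then $A_q$ is the largest $A>0$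 such that $$A\Bigl(\sum_{j=1}^n|a_j|^2\Bigr)^{1/2}\le\Bigl(\int_0^1\Bigl|\sum_{j=1}^n a_j r_j(t)\Bigr|^q dt\Bigr)^{1/q}\qquad\text{for all } n \text{ and all } a_1,\dots,a_n\in\mathbb{R},$$ where $r_j(t)=\operatorname{sign}(\sin(2^j\pi t))$ are the Rademacher functions. If $\mathbb{K}=\mathbb{C}$, then $A_q$ is the largest $A>0$ such that $$A\Bigl(\sum_{j=1}^n|a_j|^2\Bigr)^{1/2}\le\Bigl(\int_{[0,1]^n}\Bigl|\sum_{j=1}^n a_j e^{2\pi i t_j}\Bigr|^q dt\Bigr)^{1/q}\qquad\text{for all } n \text{ and all } a_1,\dots,a_n\in\mathbb{C}$$ (Steinhaus variables). Then $$B^{\mathbb{K}}_{m,(q_1,\dots,q_m)}\le\prod_{j=2}^m A_{\frac{2j-2}{j}}^{-1},$$ and the inequality above holds for all $n$ and $T$ with $C=\prod_{j=2}^m A_{\frac{2j-2}{j}}^{-1}$. -/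

import Mathlib

open MeasureTheory Finset

noncomputable section

/-- The mixed `(q₁, …, q_m)`-norm of a nonnegative array `a`, with the sum over the first index
outermost: `(∑_{j₁} ( … (∑_{j_m} a_{j₁…j_m} ^ q_m) ^ (q_{m-1} / q_m) … )) ^ (1 / q₁)`. -/
def mixedNorm {n : ℕ} : {m : ℕ} → (Fin m → ℝ) → ((Fin m → Fin n) → ℝ) → ℝ
  | 0, _, a => a Fin.elim0
  | _ + 1, q, a =>
      (∑ j : Fin n, mixedNorm (Fin.tail q) (fun i => a (Fin.cons j i)) ^ q 0) ^ (1 / q 0)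

/-- `C ≥ 1` is an admissible constant in the generalized Bohnenblust–Hille inequality with exponents
`q = (q₁, …, q_m)` over `𝕜`. The space `Fin n → 𝕜` carries the sup norm, so it is `ℓ_∞ⁿ`, and `‖T‖`
is the usual norm of a multilinear form. -/
def IsBHConstant (𝕜 : Type) [RCLike 𝕜] {m : ℕ} (q : Fin m → ℝ) (C : ℝ) : Prop :=
  1 ≤ C ∧ ∀ n : ℕ, 0 < n →
    ∀ T : ContinuousMultilinearMap 𝕜 (fun _ : Fin m => Fin n → 𝕜) 𝕜,
      mixedNorm q (fun j : Fin m → Fin n => ‖T (fun k => Pi.single (j k) (1 : 𝕜))‖) ≤ C * ‖T‖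

/-- The optimal generalized Bohnenblust–Hille constant. -/
def bhConstant (𝕜 : Type) [RCLike 𝕜] {m : ℕ} (q : Fin m → ℝ) : ℝ :=
  sInf {C : ℝ | IsBHConstant 𝕜 q C}

/-- The Rademacher functions `r_j(t) = sign (sin (2 ^ j π t))`, for `j = 1, 2, …`. -/
def rademacher (j : ℕ) (t : ℝ) : ℝ :=
  Real.sign (Real.sin (2 ^ j * Real.pi * t))

/-- `A > 0` is an admissible lower constant in the Khinchine inequality for Rademacher functions and
real scalars. The sequence is indexed from `0`, hence the shift in `rademacher (j + 1)`. -/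
def IsRealKhinchineConstant (q A : ℝ) : Prop :=
  0 < A ∧ ∀ (n : ℕ) (a : Fin n → ℝ),
    A * (∑ j, |a j| ^ 2) ^ (1 / 2 : ℝ) ≤
      (∫ t in (0 : ℝ)..1, |∑ j : Fin n, a j * rademacher (j + 1) t| ^ q) ^ (1 / q)

/-- `A > 0` is an admissible lower constant in the Khinchine inequality for Steinhaus variables
(independent and uniform on the unit circle, realized as `exp (2 π i t_j)` on the cube `[0,1]ⁿ`) and
complex scalars. -/
def IsComplexKhinchineConstant (q A : ℝ) : Prop :=
  0 < A ∧ ∀ (n : ℕ) (a : Fin n → ℂ),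
    A * (∑ j, ‖a j‖ ^ 2) ^ (1 / 2 : ℝ) ≤
      (∫ t in Set.Icc (0 : Fin n → ℝ) 1,
        ‖∑ j : Fin n, a j * Complex.exp (2 * Real.pi * Complex.I * (t j : ℂ))‖ ^ q) ^ (1 / q)

/-- The best constant `A_q` for real scalars. -/
def realKhinchine (q : ℝ) : ℝ :=
  sSup {A : ℝ | IsRealKhinchineConstant q A}

/-- The best constant `A_q` for complex scalars. -/
def complexKhinchine (q : ℝ) : ℝ :=
  sSup {A : ℝ | IsComplexKhinchineConstant q A}

end

/-! The proof is an induction on the number of variables, each step adding one Khinchine factor and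
one interpolation. Put `p = (2m-2)/m`. The exponent tuple `(p,…,p)` of length `m-1` has reciprocals
summing to `m/2`, so it is itself a case of the inequality for `(m-1)`-linear forms. Given an
`m`-linear `T`, replace its `k`-th argument by a random vector `(ε_j(ω))` of the unit ball: for each
`ω` this is an `(m-1)`-linear form of norm at most `‖T‖`. Averaging over `ω` and applying Khinchine
at exponent `p` bounds the mixed norm with `2` in slot `k` and `p` elsewhere, at the cost of `A_p⁻¹`
(`mixedNorm_update_two_le`); Minkowski brings the exponent `2` to the right place in the order of
summation.

If every `q_i > p`, the tuple `(1/q_i)` is a convex combination of the `m` tuples of reciprocals so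
obtained, and Hölder for mixed norms (`mixedNorm_le_of_interpolation`) yields the estimate for `q`
with the same constant. The upper bound on `max q_i` enters only to force `q_i > p`, by way of the
sum condition.

It remains to know that the best constants `A_q` are themselves admissible, positive and at most
`1`. Positivity comes from a crude constant `1/12`, obtained by comparing second and fourth moments.
-/

/-! ### Hölder and Minkowski inequalities for mixed norms. -/

/-- Normalise each `f k` to have sum `1` and apply weighted AM-GM at each index. If some sum
vanishes, both sides vanish. -/
theorem sum_prod_rpow_le {ι κ : Type*} [Fintype ι] [Fintype κ] (w : κ → ℝ) (hw : ∀ k, 0 < w k)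
    (hw1 : ∑ k, w k = 1) (f : κ → ι → ℝ) (hf : ∀ k j, 0 ≤ f k j) :
    ∑ j, ∏ k, f k j ^ w k ≤ ∏ k, (∑ j, f k j) ^ w k := by
  have hS : ∀ k, 0 ≤ ∑ j, f k j := fun k => sum_nonneg fun j _ => hf k j
  by_cases h : ∃ k, ∑ j, f k j = 0
  · obtain ⟨k, hk⟩ := h
    have h0 : ∀ j, f k j = 0 := fun j =>
      (sum_eq_zero_iff_of_nonneg fun j _ => hf k j).1 hk j (mem_univ j)
    refine le_trans (le_of_eq ?_) (prod_nonneg fun k _ => Real.rpow_nonneg (hS k) _)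
    refine sum_eq_zero fun j _ => prod_eq_zero (mem_univ k) ?_
    rw [h0 j, Real.zero_rpow (hw k).ne']
  · push Not at h
    have hpos : ∀ k, 0 < ∑ j, f k j := fun k => lt_of_le_of_ne (hS k) (h k).symm
    have key : ∑ j, ∏ k, (f k j / ∑ j, f k j) ^ w k ≤ 1 := by
      calc _ ≤ ∑ j, ∑ k, w k * (f k j / ∑ j, f k j) := by
            refine sum_le_sum fun j _ => ?_
            exact Real.geom_mean_le_arith_mean_weighted univ w _ (fun k _ => (hw k).le) hw1
              fun k _ => div_nonneg (hf k j) (hS k)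
        _ = ∑ k, w k := by
            rw [sum_comm]
            refine sum_congr rfl fun k _ => ?_
            rw [← mul_sum, ← sum_div, div_self (h k), mul_one]
        _ = 1 := hw1
    have hP : 0 < ∏ k, (∑ j, f k j) ^ w k := prod_pos fun k _ => Real.rpow_pos_of_pos (hpos k) _
    have e : ∑ j, ∏ k, (f k j / ∑ j, f k j) ^ w k
        = (∑ j, ∏ k, f k j ^ w k) / ∏ k, (∑ j, f k j) ^ w k := by
      rw [sum_div]
      refine sum_congr rfl fun j _ => ?_
      rw [← prod_div_distrib]
      exact prod_congr rfl fun k _ => Real.div_rpow (hf k j) (hS k) _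
    rw [e, div_le_one hP] at key
    exact key

theorem mixedNorm_nonneg {n m : ℕ} (q : Fin m → ℝ) (a : (Fin m → Fin n) → ℝ) (ha : ∀ i, 0 ≤ a i) :
    0 ≤ mixedNorm q a := by
  induction m with
  | zero => exact ha _
  | succ m ih =>
    exact Real.rpow_nonneg (sum_nonneg fun j _ => Real.rpow_nonneg (ih _ _ fun i => ha _) _) _

/-- Hölder's inequality for mixed norms. -/
theorem mixedNorm_prod_rpow_le {κ : Type*} [Fintype κ] (θ : κ → ℝ) (hθ : ∀ k, 0 < θ k)
    {n m : ℕ} (q : Fin m → ℝ) (hq : ∀ i, 0 < q i) (Q : κ → Fin m → ℝ) (hQ : ∀ k i, 0 < Q k i)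
    (h : ∀ i, ∑ k, θ k / Q k i = 1 / q i)
    (a : κ → (Fin m → Fin n) → ℝ) (ha : ∀ k i, 0 ≤ a k i) :
    mixedNorm q (fun i => ∏ k, a k i ^ θ k) ≤ ∏ k, mixedNorm (Q k) (a k) ^ θ k := by
  induction m with
  | zero => exact le_rfl
  | succ m ih =>
    set N : κ → Fin n → ℝ := fun k j => mixedNorm (Fin.tail (Q k)) (fun i => a k (Fin.cons j i))
    have hN : ∀ k j, 0 ≤ N k j := fun k j => mixedNorm_nonneg _ _ fun i => ha _ _
    have hq0 := hq 0
    have h1 : ∀ j, mixedNorm (Fin.tail q) (fun i => ∏ k, a k (Fin.cons j i) ^ θ k)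
        ≤ ∏ k, N k j ^ θ k := fun j =>
      ih (Fin.tail q) (fun i => hq i.succ) (fun k => Fin.tail (Q k)) (fun k i => hQ k i.succ)
        (fun i => h i.succ) (fun k i => a k (Fin.cons j i)) fun k i => ha _ _
    -- The hypothesis `h 0` says exactly that the weights `θ k * q 0 / Q k 0` sum to `1`, so Hölder
    -- applies to the outermost sum.
    have h2 : ∑ j, mixedNorm (Fin.tail q) (fun i => ∏ k, a k (Fin.cons j i) ^ θ k) ^ q 0
        ≤ ∏ k, (∑ j, N k j ^ Q k 0) ^ (θ k * q 0 / Q k 0) := by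
      refine le_trans (sum_le_sum fun j _ => Real.rpow_le_rpow
        (mixedNorm_nonneg _ _ fun i => prod_nonneg fun k _ => Real.rpow_nonneg (ha _ _) _)
        (h1 j) hq0.le) ?_
      refine le_trans (le_of_eq ?_) (sum_prod_rpow_le (fun k => θ k * q 0 / Q k 0)
        (fun k => div_pos (mul_pos (hθ k) hq0) (hQ k 0)) ?_ (fun k j => N k j ^ Q k 0)
        fun k j => Real.rpow_nonneg (hN k j) _)
      · refine sum_congr rfl fun j _ => ?_
        rw [← Real.finsetProd_rpow _ _ fun k _ => Real.rpow_nonneg (hN k j) _]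
        refine prod_congr rfl fun k _ => ?_
        rw [← Real.rpow_mul (hN k j), ← Real.rpow_mul (hN k j)]
        congr 1
        field_simp [(hQ k 0).ne']
      · have := h 0
        calc ∑ k, θ k * q 0 / Q k 0 = (∑ k, θ k / Q k 0) * q 0 := by
              rw [sum_mul]; exact sum_congr rfl fun k _ => by ring
          _ = 1 := by rw [this]; field_simp
    have hS : ∀ k, 0 ≤ ∑ j, N k j ^ Q k 0 := fun k =>
      sum_nonneg fun j _ => Real.rpow_nonneg (hN k j) _
    refine le_trans (Real.rpow_le_rpow (sum_nonneg fun j _ => Real.rpow_nonneg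
      (mixedNorm_nonneg _ _ fun i => prod_nonneg fun k _ => Real.rpow_nonneg (ha _ _) _) _) h2
      (one_div_nonneg.2 hq0.le)) (le_of_eq ?_)
    rw [← Real.finsetProd_rpow _ _ fun k _ => Real.rpow_nonneg (hS k) _]
    refine prod_congr rfl fun k _ => ?_
    change _ = ((∑ j, N k j ^ Q k 0) ^ (1 / Q k 0)) ^ θ k
    rw [← Real.rpow_mul (hS k), ← Real.rpow_mul (hS k)]
    congr 1
    field_simp [(hQ k 0).ne']

/-- Hölder with all arrays equal to `a`, since `∏ k, x ^ θ k = x`. -/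
theorem mixedNorm_le_of_interpolation {κ : Type*} [Fintype κ] (θ : κ → ℝ) (hθ : ∀ k, 0 < θ k)
    (hθ1 : ∑ k, θ k = 1) {n m : ℕ} (q : Fin m → ℝ) (hq : ∀ i, 0 < q i) (Q : κ → Fin m → ℝ)
    (hQ : ∀ k i, 0 < Q k i) (h : ∀ i, ∑ k, θ k / Q k i = 1 / q i)
    (a : (Fin m → Fin n) → ℝ) (ha : ∀ i, 0 ≤ a i) (M : ℝ) (hM0 : 0 ≤ M)
    (hM : ∀ k, mixedNorm (Q k) a ≤ M) :
    mixedNorm q a ≤ M := by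
  have e : ∀ x : ℝ, 0 ≤ x → ∏ k, x ^ θ k = x := fun x hx => by
    rw [← Real.rpow_sum_of_nonneg hx fun k _ => (hθ k).le, hθ1, Real.rpow_one]
  calc mixedNorm q a = mixedNorm q (fun i => ∏ k, a i ^ θ k) := by
        congr 1; ext i; exact (e _ (ha i)).symm
    _ ≤ ∏ k, mixedNorm (Q k) a ^ θ k :=
        mixedNorm_prod_rpow_le θ hθ q hq Q hQ h (fun _ => a) fun _ => ha
    _ ≤ ∏ k, M ^ θ k := prod_le_prod (fun k _ => Real.rpow_nonneg (mixedNorm_nonneg _ _ ha) _)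
        fun k _ => Real.rpow_le_rpow (mixedNorm_nonneg _ _ ha) (hM k) (hθ k).le
    _ = M := e M hM0

theorem sum_fin_cons {n m : ℕ} (f : (Fin (m + 1) → Fin n) → ℝ) :
    ∑ i, f i = ∑ j, ∑ i : Fin m → Fin n, f (Fin.cons j i) := by
  rw [← (Fin.consEquiv fun _ : Fin (m + 1) => Fin n).sum_comp, Fintype.sum_prod_type]
  rfl

theorem mixedNorm_const {n m : ℕ} (p : ℝ) (hp : 0 < p) (a : (Fin m → Fin n) → ℝ)
    (ha : ∀ i, 0 ≤ a i) : mixedNorm (fun _ => p) a ^ p = ∑ i, a i ^ p := by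
  induction m with
  | zero => rw [Fintype.sum_unique]; congr 1
  | succ m ih =>
    rw [sum_fin_cons, mixedNorm, one_div, Real.rpow_inv_rpow _ hp.ne']
    · exact sum_congr rfl fun j _ => ih _ fun i => ha _
    · exact sum_nonneg fun j _ => Real.rpow_nonneg (mixedNorm_nonneg _ _ fun i => ha _) _

theorem Lp_sum_le {ι κ : Type*} [Fintype ι] (s : Finset κ) {r : ℝ} (hr : 1 ≤ r)
    (b : κ → ι → ℝ) (hb : ∀ k j, 0 ≤ b k j) :
    (∑ j, (∑ k ∈ s, b k j) ^ r) ^ (1 / r) ≤ ∑ k ∈ s, (∑ j, b k j ^ r) ^ (1 / r) := by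
  classical
  induction s using Finset.induction_on with
  | empty =>
    have : r ≠ 0 := by linarith
    simp [Real.zero_rpow this, Real.zero_rpow (inv_ne_zero this)]
  | insert k s hk ih =>
    simp only [sum_insert hk]
    refine le_trans (Real.Lp_add_le_of_nonneg univ hr (fun j _ => hb k j)
      fun j _ => sum_nonneg fun k _ => hb k j) ?_
    gcongr

/-- Minkowski: the mixed norm with one exponent `2` and the others `p ≤ 2` is largest when the
exponent `2` is innermost. -/
theorem mixedNorm_update_two_rpow_le {n m : ℕ} (p : ℝ) (hp : 0 < p) (hp2 : p ≤ 2)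
    (k : Fin (m + 1)) (a : (Fin (m + 1) → Fin n) → ℝ) (ha : ∀ i, 0 ≤ a i) :
    mixedNorm (Function.update (fun _ => p) k 2) a ^ p
      ≤ ∑ i : Fin m → Fin n, (∑ j, a (k.insertNth j i) ^ (2 : ℝ)) ^ (p / 2) := by
  induction m with
  | zero =>
    obtain rfl : k = 0 := Subsingleton.elim (α := Fin 1) k 0
    rw [Fintype.sum_unique]
    simp only [mixedNorm, Function.update_self]
    rw [← Real.rpow_mul (sum_nonneg fun j _ => Real.rpow_nonneg (ha _) _)]
    refine le_of_eq ?_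
    congr 1
    · refine sum_congr rfl fun j _ => ?_
      congr 2
      rw [Fin.insertNth_zero']
      congr 1
    · ring
  | succ m ih =>
    refine Fin.cases ?_ (fun k => ?_) k
    -- The exponent `2` is outermost: the triangle inequality in `ℓ_{2/p}`, applied to the `p`-th
    -- powers, moves it inside all other sums at once.
    · have hr : 1 ≤ 2 / p := by rwa [le_div_iff₀ hp, one_mul]
      have ht : Fin.tail (Function.update (fun _ : Fin (m + 1 + 1) => p) 0 2) = fun _ => p := by
        ext i; simp [Fin.tail]
      rw [mixedNorm, ht]
      simp only [Function.update_self, Fin.insertNth_zero']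
      have h0 : ∀ j, 0 ≤ mixedNorm (fun _ => p) (fun i => a (Fin.cons j i)) := fun j =>
        mixedNorm_nonneg _ _ fun i => ha _
      rw [← Real.rpow_mul (sum_nonneg fun j _ => Real.rpow_nonneg (h0 j) _)]
      have := Lp_sum_le (univ : Finset (Fin (m + 1) → Fin n)) hr
        (fun i j => a (Fin.cons j i) ^ p) fun i j => Real.rpow_nonneg (ha _) _
      refine le_trans (le_of_eq ?_) (le_trans this (le_of_eq ?_))
      · congr 1
        · refine sum_congr rfl fun j _ => ?_
          rw [← mixedNorm_const p hp _ fun i => ha _, ← Real.rpow_mul (h0 j)]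
          congr 1; field_simp
        · field_simp
      · refine sum_congr rfl fun i _ => ?_
        congr 1
        · refine sum_congr rfl fun j _ => ?_
          rw [← Real.rpow_mul (ha _)]
          congr 1; field_simp
        · field_simp
    -- The outermost exponent is `p`, so after raising to the power `p` the induction hypothesis
    -- applies to each slice.
    · have ht : Fin.tail (Function.update (fun _ : Fin (m + 1 + 1) => p) k.succ 2)
          = Function.update (fun _ => p) k 2 := by
        ext i; simp [Fin.tail, Function.update_apply]
      have hz : Function.update (fun _ : Fin (m + 1 + 1) => p) k.succ 2 0 = p := by
        simp [(Fin.succ_ne_zero k).symm]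
      rw [mixedNorm, ht, hz, sum_fin_cons, one_div, Real.rpow_inv_rpow _ hp.ne']
      · refine sum_le_sum fun j _ => ?_
        refine le_trans (ih k _ fun i => ha _) (le_of_eq ?_)
        simp only [Fin.insertNth_succ_cons]
      · exact sum_nonneg fun j _ => Real.rpow_nonneg (mixedNorm_nonneg _ _ fun i => ha _) _

/-! ### The inductive step: Khinchine in one variable, then interpolation. -/

/-- `A > 0` is a lower Khinchine constant with exponent `q` for some sequence of measurable functions
bounded by `1` on a probability space. -/
def HasKhinchine (𝕜 : Type) [RCLike 𝕜] (q A : ℝ) : Prop :=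
  0 < A ∧ ∀ n : ℕ, ∃ (Ω : Type) (_ : MeasurableSpace Ω) (μ : Measure Ω) (ε : Fin n → Ω → 𝕜),
    IsProbabilityMeasure μ ∧ (∀ j, Measurable (ε j)) ∧ (∀ j ω, ‖ε j ω‖ ≤ 1) ∧
    ∀ a : Fin n → 𝕜,
      A * (∑ j, ‖a j‖ ^ 2) ^ (1 / 2 : ℝ) ≤ (∫ ω, ‖∑ j, a j * ε j ω‖ ^ q ∂μ) ^ (1 / q)

section
variable {𝕜 : Type} [RCLike 𝕜]

theorem map_insertNth_pi_single {n m : ℕ}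
    (T : ContinuousMultilinearMap 𝕜 (fun _ : Fin (m + 1) => Fin n → 𝕜) 𝕜) (k : Fin (m + 1))
    (x : Fin n → 𝕜) (i : Fin m → Fin n) :
    T.curryMid k x (fun l => Pi.single (i l) 1)
      = ∑ j, T (fun l => Pi.single ((k.insertNth j i : Fin (m + 1) → Fin n) l) 1) * x j := by
  have hx : x = ∑ j, x j • (Pi.single j 1 : Fin n → 𝕜) := by
    conv_lhs => rw [pi_eq_sum_univ' x]
  conv_lhs => rw [hx, map_sum, _root_.sum_apply]
  refine sum_congr rfl fun j _ => ?_
  rw [map_smul, _root_.smul_apply, smul_eq_mul, mul_comm,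
    ContinuousMultilinearMap.curryMid_apply]
  congr 2
  symm
  refine Fin.eq_insertNth_iff.2 ⟨by simp, ?_⟩
  ext l : 1
  simp [Fin.removeNth]

theorem mixedNorm_update_two_le {p A C : ℝ} (hp : 0 < p) (hp2 : p ≤ 2) (hA : HasKhinchine 𝕜 p A)
    {n m : ℕ} (hC0 : 0 ≤ C)
    (hC : ∀ S : ContinuousMultilinearMap 𝕜 (fun _ : Fin m => Fin n → 𝕜) 𝕜,
      mixedNorm (fun _ => p) (fun j => ‖S (fun l => Pi.single (j l) (1 : 𝕜))‖) ≤ C * ‖S‖)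
    (T : ContinuousMultilinearMap 𝕜 (fun _ : Fin (m + 1) => Fin n → 𝕜) 𝕜) (k : Fin (m + 1)) :
    mixedNorm (Function.update (fun _ => p) k 2)
      (fun j => ‖T (fun l => Pi.single (j l) (1 : 𝕜))‖) ≤ C * A⁻¹ * ‖T‖ := by
  obtain ⟨hA0, hA⟩ := hA
  obtain ⟨Ω, _, μ, ε, _, hm, hε, hK⟩ := hA n
  set t : Fin n → (Fin m → Fin n) → 𝕜 := fun j i =>
    T (fun l => Pi.single ((k.insertNth j i : Fin (m + 1) → Fin n) l) 1) with ht
  have hint : ∀ i, Integrable (fun ω => ‖∑ j, t j i * ε j ω‖ ^ p) μ := fun i => by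
    refine Integrable.of_bound (C := (∑ j, ‖t j i‖) ^ p) ?_ (ae_of_all _ fun ω => ?_)
    · refine Measurable.aestronglyMeasurable ?_
      fun_prop
    · rw [Real.norm_of_nonneg (by positivity)]
      refine Real.rpow_le_rpow (norm_nonneg _) ((norm_sum_le _ _).trans ?_) hp.le
      refine sum_le_sum fun j _ => ?_
      rw [norm_mul]
      exact mul_le_of_le_one_right (norm_nonneg _) (hε j ω)
  -- Since `|ε_j(ω)| ≤ 1`, the vector `(ε_j(ω))` lies in the unit ball of `ℓ_∞ⁿ`. This bound is all
  -- that is used of the `ε_j` besides measurability and Khinchine; independence plays no role.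
  have hpt : ∀ ω, ∑ i, ‖∑ j, t j i * ε j ω‖ ^ p ≤ (C * ‖T‖) ^ p := fun ω => by
    set S := T.curryMid k (fun j => ε j ω)
    have hS : ‖S‖ ≤ ‖T‖ := by
      refine (ContinuousLinearMap.le_opNorm _ _).trans ?_
      rw [ContinuousMultilinearMap.norm_curryMid]
      exact mul_le_of_le_one_right (norm_nonneg _)
        ((pi_norm_le_iff_of_nonneg zero_le_one).2 fun j => hε j ω)
    have h1 := mixedNorm_const p hp (fun i : Fin m → Fin n => ‖S (fun l => Pi.single (i l) 1)‖)
      fun i => norm_nonneg _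
    calc _ = ∑ i : Fin m → Fin n, ‖S (fun l => Pi.single (i l) 1)‖ ^ p := by
          refine sum_congr rfl fun i _ => ?_
          rw [map_insertNth_pi_single]
      _ = _ := h1.symm
      _ ≤ _ := Real.rpow_le_rpow (mixedNorm_nonneg _ _ fun i => norm_nonneg _)
          ((hC S).trans (mul_le_mul_of_nonneg_left hS hC0)) hp.le
  have hkh : ∀ i, (∑ j, ‖t j i‖ ^ (2 : ℝ)) ^ (p / 2)
      ≤ A⁻¹ ^ p * ∫ ω, ‖∑ j, t j i * ε j ω‖ ^ p ∂μ := fun i => by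
    have h0 : 0 ≤ ∑ j, ‖t j i‖ ^ 2 := sum_nonneg fun j _ => sq_nonneg _
    have hI : 0 ≤ ∫ ω, ‖∑ j, t j i * ε j ω‖ ^ p ∂μ := integral_nonneg fun ω => by positivity
    have h1 := hK fun j => t j i
    have h2 : (∑ j, ‖t j i‖ ^ 2) ^ (1 / 2 : ℝ)
        ≤ A⁻¹ * (∫ ω, ‖∑ j, t j i * ε j ω‖ ^ p ∂μ) ^ (1 / p) := by
      rwa [inv_mul_eq_div, le_div_iff₀ hA0, mul_comm]
    have h3 := Real.rpow_le_rpow (by positivity) h2 hp.le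
    rw [← Real.rpow_mul h0, Real.mul_rpow (by positivity) (by positivity), ← Real.rpow_mul hI,
      one_div_mul_cancel hp.ne', Real.rpow_one] at h3
    simp only [Real.rpow_two]
    convert h3 using 2
    ring
  have hmink := mixedNorm_update_two_rpow_le p hp hp2 k
    (fun j => ‖T (fun l => Pi.single (j l) (1 : 𝕜))‖) fun i => norm_nonneg _
  have hmain : mixedNorm (Function.update (fun _ => p) k 2)
      (fun j => ‖T (fun l => Pi.single (j l) (1 : 𝕜))‖) ^ p ≤ (C * A⁻¹ * ‖T‖) ^ p := by
    calc _ ≤ ∑ i : Fin m → Fin n, (∑ j, ‖t j i‖ ^ (2 : ℝ)) ^ (p / 2) :=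
          hmink
      _ ≤ ∑ i, A⁻¹ ^ p * ∫ ω, ‖∑ j, t j i * ε j ω‖ ^ p ∂μ := sum_le_sum fun i _ => hkh i
      _ = A⁻¹ ^ p * ∫ ω, ∑ i, ‖∑ j, t j i * ε j ω‖ ^ p ∂μ := by
          rw [← mul_sum]
          congr 1
          exact (integral_finsetSum _ fun i _ => hint i).symm
      _ ≤ A⁻¹ ^ p * ∫ ω, (C * ‖T‖) ^ p ∂μ := by
          refine mul_le_mul_of_nonneg_left ?_ (by positivity)
          exact integral_mono (integrable_finsetSum _ fun i _ => hint i) (integrable_const _) hpt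
      _ = _ := by
          rw [integral_const, probReal_univ, one_smul, ← Real.mul_rpow (by positivity)
            (by positivity)]
          congr 1; ring
  exact (Real.rpow_le_rpow_iff (mixedNorm_nonneg _ _ fun i => norm_nonneg _) (by positivity) hp).1
    hmain

/-- The base case: testing on the vector of conjugate phases of the coefficients gives their `ℓ₁`
norm. -/
theorem mixedNorm_one_le {n : ℕ}
    (T : ContinuousMultilinearMap 𝕜 (fun _ : Fin 1 => Fin n → 𝕜) 𝕜) :
    mixedNorm (fun _ => 1) (fun j => ‖T (fun l => Pi.single (j l) (1 : 𝕜))‖) ≤ ‖T‖ := by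
  set t : Fin n → 𝕜 := fun j =>
    T (fun l => Pi.single (((0 : Fin 1).insertNth j Fin.elim0 : Fin 1 → Fin n) l) 1) with ht
  -- Where `t j = 0`, division by zero makes `x j = 0`, which is harmless.
  set x : Fin n → 𝕜 := fun j => (starRingEnd 𝕜) (t j) / (‖t j‖ : 𝕜)
  have hx : ∀ j, ‖x j‖ ≤ 1 := fun j => by
    simp only [x, norm_div, RCLike.norm_conj, RCLike.norm_ofReal, abs_norm]
    exact div_self_le_one _
  have htx : ∀ j, t j * x j = (‖t j‖ : 𝕜) := fun j => by
    by_cases h : t j = 0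
    · simp [h]
    · have : (‖t j‖ : 𝕜) ≠ 0 := by simpa using h
      simp only [x]
      rw [← mul_div_assoc, RCLike.mul_conj, div_eq_iff this, sq]
  have h1 : mixedNorm (fun _ => 1) (fun j => ‖T (fun l => Pi.single (j l) (1 : 𝕜))‖)
      = ∑ j, ‖t j‖ := by
    simp only [mixedNorm, Real.rpow_one, div_one]
    refine sum_congr rfl fun j _ => ?_
    rw [ht]
    simp only [Fin.insertNth_zero']
  have h2 := map_insertNth_pi_single T 0 x Fin.elim0
  have h3 : ‖∑ j, t j * x j‖ = ∑ j, ‖t j‖ := by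
    simp only [htx]
    rw [← RCLike.ofReal_sum, RCLike.norm_ofReal, abs_of_nonneg (sum_nonneg fun j _ => norm_nonneg _)]
  rw [h1, ← h3, ← h2]
  refine (ContinuousMultilinearMap.le_opNorm _ _).trans ?_
  simp only [univ_eq_empty, prod_empty, mul_one]
  refine (ContinuousLinearMap.le_opNorm _ _).trans ?_
  rw [ContinuousMultilinearMap.norm_curryMid]
  exact mul_le_of_le_one_right (norm_nonneg _) ((pi_norm_le_iff_of_nonneg zero_le_one).2 hx)

/-- The form is `(m+1)`-linear, so the lower bound on `q i` is the exponent `(2j-2)/j` at `j = m+1`.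
The strict bound makes all interpolation weights positive, and it is inherited by the constant tuple
used in the induction. -/
theorem mixedNorm_le_prod_khinchine (K : ℝ → ℝ) (hK : ∀ p, 1 ≤ p → p < 2 → HasKhinchine 𝕜 p (K p))
    (m : ℕ) (q : Fin (m + 1) → ℝ) (hq : ∀ i, 2 * (m : ℝ) / (m + 1) < q i)
    (hsum : ∑ i, 1 / q i = ((m : ℝ) + 2) / 2) (n : ℕ)
    (T : ContinuousMultilinearMap 𝕜 (fun _ : Fin (m + 1) => Fin n → 𝕜) 𝕜) :
    mixedNorm q (fun j => ‖T (fun l => Pi.single (j l) (1 : 𝕜))‖)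
      ≤ (∏ j ∈ Finset.Icc 2 (m + 1), (K ((2 * (j : ℝ) - 2) / j))⁻¹) * ‖T‖ := by
  induction m with
  | zero =>
    have hq1 : q = fun _ => 1 := by
      ext i
      obtain rfl : i = 0 := Subsingleton.elim (α := Fin 1) i 0
      have : (q 0)⁻¹ = 1 := by simpa using hsum
      exact inv_eq_one.1 this
    subst hq1
    simpa using mixedNorm_one_le T
  | succ m ih =>
    have hm0 : (0 : ℝ) ≤ m := m.cast_nonneg
    set p : ℝ := 2 * (m + 1) / (m + 2) with hp
    have hp1 : 1 ≤ p := by rw [hp, le_div_iff₀ (by positivity)]; linarith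
    have hp2 : p < 2 := by rw [hp, div_lt_iff₀ (by positivity)]; linarith
    have hp0 : 0 < p := by linarith
    have hpinv : 1 / p = (m + 2) / (2 * (m + 1)) := by rw [hp, one_div_div]
    have hKp := hK p hp1 hp2
    set C := ∏ j ∈ Finset.Icc 2 (m + 1), (K ((2 * (j : ℝ) - 2) / j))⁻¹ with hCdef
    have hC0 : 0 ≤ C := by
      refine prod_nonneg fun j hj => inv_nonneg.2 (hK _ ?_ ?_).1.le
      all_goals
        have hj2 : (2 : ℝ) ≤ j := by exact_mod_cast (mem_Icc.1 hj).1
      · rw [le_div_iff₀ (by linarith)]; linarith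
      · rw [div_lt_iff₀ (by linarith)]; linarith
    have hCs : ∏ j ∈ Finset.Icc 2 (m + 1 + 1), (K ((2 * (j : ℝ) - 2) / j))⁻¹ = C * (K p)⁻¹ := by
      rw [prod_Icc_succ_top (by omega)]
      congr 3
      push_cast
      rw [hp]
      congr 1 <;> ring
    -- The exponents `(2j-2)/j` increase with `j`, so the constant tuple `p` meets the strict lower
    -- bound one level down.
    have hstep : ∀ k, mixedNorm (Function.update (fun _ => p) k 2)
        (fun j => ‖T (fun l => Pi.single (j l) (1 : 𝕜))‖) ≤ C * (K p)⁻¹ * ‖T‖ := by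
      refine mixedNorm_update_two_le hp0 hp2.le hKp hC0 (fun S => ?_) T
      refine ih (fun _ => p) (fun _ => ?_) ?_ S
      · rw [hp, div_lt_div_iff₀ (by positivity) (by positivity)]; nlinarith
      · rw [hpinv]
        simp
        field_simp
    rw [hCs]
    have hqp : ∀ i, p < q i := fun i => by
      have := hq i
      push_cast at this
      rw [hp]
      convert this using 2
      ring
    have hq0 : ∀ i, 0 < q i := fun i => hp0.trans (hqp i)
    have hd : 0 < 1 / p - 1 / 2 := sub_pos.2 (one_div_lt_one_div_of_lt hp0 hp2)
    have hdv : 1 / p - 1 / 2 = 1 / (2 * (m + 1)) := by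
      rw [hpinv]; field_simp; ring
    have hθ1 : ∑ k, (1 / p - 1 / q k) / (1 / p - 1 / 2) = 1 := by
      rw [← sum_div, sum_sub_distrib, hsum, div_eq_one_iff_eq hd.ne', hdv, hpinv]
      simp
      field_simp
      ring
    -- The weights solve `(1 - θ_k)/p + θ_k/2 = 1/q_k`; the condition on `∑ 1/q_k` is what makes
    -- them sum to `1`.
    refine mixedNorm_le_of_interpolation (fun k => (1 / p - 1 / q k) / (1 / p - 1 / 2))
      (fun k => div_pos (sub_pos.2 (one_div_lt_one_div_of_lt hp0 (hqp k))) hd) hθ1 q hq0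
      (fun k => Function.update (fun _ => p) k 2) (fun k i => ?_) (fun i => ?_) _
      (fun i => norm_nonneg _) _
      (mul_nonneg (mul_nonneg hC0 (inv_nonneg.2 hKp.1.le)) (norm_nonneg _)) hstep
    · rw [Function.update_apply]; split_ifs <;> linarith
    -- Each tuple of reciprocals is written as the constant `1/p` minus a correction in slot `k`, so
    -- that the sum over `k` collapses to `1/p - (1/p - 1/q i)`.
    · have e : ∀ k, (1 / p - 1 / q k) / (1 / p - 1 / 2) / Function.update (fun _ => p) k 2 i
          = (1 / p - 1 / q k) / (1 / p - 1 / 2) * (1 / p) -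
            if i = k then (1 / p - 1 / q k) else 0 := fun k => by
        rw [Function.update_apply]
        split_ifs with h
        · generalize 1 / p - 1 / q k = X
          have hpd : 1 / p = (1 / p - 1 / 2) + 1 / 2 := by ring
          generalize 1 / p - 1 / 2 = d at hd hpd
          rw [hpd]
          field_simp
          ring
        · rw [sub_zero, mul_one_div]
      simp only [e]
      rw [sum_sub_distrib, ← sum_mul, hθ1, sum_ite_eq, if_pos (mem_univ i)]
      ring

end

/-! ### Lower moments from the second and fourth moments. -/

theorem rpow_ge_sq_sub_pow_four {x q : ℝ} (hx : 0 ≤ x) (hq0 : 0 < q) (hq2 : q ≤ 2) :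
    x ^ 2 - x ^ 4 ≤ x ^ q := by
  rcases le_total x 1 with h | h
  · have h1 : x ^ (2 : ℝ) ≤ x ^ q := by
      rcases hx.eq_or_lt with rfl | h0
      · rw [Real.zero_rpow hq0.ne', Real.zero_rpow two_ne_zero]
      · exact Real.rpow_le_rpow_of_exponent_ge h0 h hq2
    rw [Real.rpow_two] at h1
    have : 0 ≤ x ^ 4 := by positivity
    linarith
  · have h1 : x ^ 2 ≤ x ^ 4 := pow_le_pow_right₀ h (by norm_num)
    have : 0 ≤ x ^ q := by positivity
    linarith

theorem integrable_rpow_of_bounded {Ω : Type*} [MeasurableSpace Ω] {μ : Measure Ω}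
    [IsFiniteMeasure μ] {f : Ω → ℝ} (hf : Measurable f) (hf0 : ∀ ω, 0 ≤ f ω) {B : ℝ}
    (hB : ∀ ω, f ω ≤ B) {q : ℝ} (hq : 0 < q) : Integrable (fun ω => f ω ^ q) μ := by
  refine Integrable.of_bound (C := B ^ q) (hf.pow_const q).aestronglyMeasurable
    (ae_of_all _ fun ω => ?_)
  rw [Real.norm_of_nonneg (Real.rpow_nonneg (hf0 ω) _)]
  exact Real.rpow_le_rpow (hf0 ω) (hB ω) hq.le

theorem integrable_pow_of_bounded {Ω : Type*} [MeasurableSpace Ω] {μ : Measure Ω}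
    [IsFiniteMeasure μ] {f : Ω → ℝ} (hf : Measurable f) (hf0 : ∀ ω, 0 ≤ f ω) {B : ℝ}
    (hB : ∀ ω, f ω ≤ B) (k : ℕ) : Integrable (fun ω => f ω ^ k) μ := by
  refine Integrable.of_bound (C := B ^ k) (hf.pow_const k).aestronglyMeasurable
    (ae_of_all _ fun ω => ?_)
  rw [Real.norm_of_nonneg (pow_nonneg (hf0 ω) _)]
  exact pow_le_pow_left₀ (hf0 ω) (hB ω) _

/-- Control of the fourth moment by the second one bounds the lower moments from below. -/
theorem sqrt_le_of_moments {Ω : Type*} [MeasurableSpace Ω] {μ : Measure Ω}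
    [IsFiniteMeasure μ] {f : Ω → ℝ} (hf : Measurable f) (hf0 : ∀ ω, 0 ≤ f ω) {B : ℝ}
    (hB : ∀ ω, f ω ≤ B) {q : ℝ} (hq1 : 1 ≤ q) (hq2 : q ≤ 2) {v : ℝ} (hv : 0 ≤ v)
    (h2 : ∫ ω, f ω ^ 2 ∂μ = v) (h4 : ∫ ω, f ω ^ 4 ∂μ ≤ 3 * v ^ 2) :
    1 / 12 * v ^ (1 / 2 : ℝ) ≤ (∫ ω, f ω ^ q ∂μ) ^ (1 / q) := by
  have hq0 : 0 < q := by linarith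
  rcases hv.eq_or_lt with rfl | hv
  · rw [Real.zero_rpow (by norm_num), mul_zero]
    exact Real.rpow_nonneg (integral_nonneg fun ω => Real.rpow_nonneg (hf0 ω) _) _
  rw [← Real.sqrt_eq_rpow]
  -- Rescaling by `l` and integrating `x² - x⁴ ≤ x^q` gives `1/6 - 3/36 = 1/12`.
  set l := Real.sqrt (6 * v) with hl
  have hl0 : 0 < l := Real.sqrt_pos.2 (by positivity)
  have hl2 : l ^ 2 = 6 * v := Real.sq_sqrt (by positivity)
  have hl4 : l ^ 4 = 36 * v ^ 2 := by
    calc l ^ 4 = (l ^ 2) ^ 2 := by ring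
      _ = _ := by rw [hl2]; ring
  have hpt : ∀ ω, l ^ q * (f ω ^ 2 / (6 * v) - f ω ^ 4 / (36 * v ^ 2)) ≤ f ω ^ q := fun ω => by
    have := rpow_ge_sq_sub_pow_four (div_nonneg (hf0 ω) hl0.le) hq0 hq2
    rw [div_pow, div_pow, hl2, hl4, Real.div_rpow (hf0 ω) hl0.le,
      le_div_iff₀ (Real.rpow_pos_of_pos hl0 _)] at this
    linarith
  have i2 := integrable_pow_of_bounded (μ := μ) hf hf0 hB 2
  have i4 := integrable_pow_of_bounded (μ := μ) hf hf0 hB 4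
  have hI : l ^ q * (1 / 12) ≤ ∫ ω, f ω ^ q ∂μ := by
    refine le_trans ?_ (integral_mono (((i2.div_const _).sub (i4.div_const _)).const_mul _)
      (integrable_rpow_of_bounded hf hf0 hB hq0) hpt)
    simp only [Pi.sub_apply]
    rw [integral_const_mul, integral_sub (i2.div_const _) (i4.div_const _), integral_div,
      integral_div, h2]
    refine mul_le_mul_of_nonneg_left ?_ (by positivity)
    have e1 : v / (6 * v) = 1 / 6 := by field_simp
    have e2 : (∫ ω, f ω ^ 4 ∂μ) / (36 * v ^ 2) ≤ 1 / 12 := by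
      rw [div_le_iff₀ (by positivity)]; linarith
    rw [e1]; linarith
  calc 1 / 12 * √v ≤ 1 / 12 * l := by
        refine mul_le_mul_of_nonneg_left (Real.sqrt_le_sqrt (by linarith)) (by norm_num)
    _ ≤ (1 / 12 : ℝ) ^ (1 / q) * l := by
        refine mul_le_mul_of_nonneg_right ?_ hl0.le
        conv_lhs => rw [← Real.rpow_one (1 / 12 : ℝ)]
        refine Real.rpow_le_rpow_of_exponent_ge (by norm_num) (by norm_num) ?_
        rw [div_le_one hq0]; exact hq1
    _ = (l ^ q * (1 / 12)) ^ (1 / q) := by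
        rw [Real.mul_rpow (by positivity) (by norm_num), ← Real.rpow_mul hl0.le,
          mul_one_div_cancel hq0.ne', Real.rpow_one, mul_comm]
    _ ≤ _ := Real.rpow_le_rpow (by positivity) hI (by positivity)

/-! ### Moments of Rademacher sums. -/

theorem abs_rademacher_le (j : ℕ) (t : ℝ) : |rademacher j t| ≤ 1 := by
  unfold rademacher
  rcases Real.sign_apply_eq (Real.sin (2 ^ j * Real.pi * t)) with h | h | h <;> simp [h]

theorem measurable_rademacher (j : ℕ) : Measurable (rademacher j) := by
  have h : Measurable Real.sign := by
    unfold Real.sign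
    exact Measurable.ite measurableSet_Iio measurable_const
      (Measurable.ite measurableSet_Ioi measurable_const measurable_const)
  exact h.comp (by fun_prop)

theorem rademacher_add_one (j : ℕ) (t : ℝ) : rademacher (j + 1) (t + 1) = rademacher (j + 1) t := by
  unfold rademacher
  rw [← Real.sin_add_nat_mul_two_pi (2 ^ (j + 1) * Real.pi * t) (2 ^ j)]
  congr 2
  push_cast
  ring

theorem rademacher_succ (j : ℕ) (t : ℝ) : rademacher (j + 1) t = rademacher j (2 * t) := by
  unfold rademacher
  congr 2
  ring

theorem rademacher_one_of_lt {t : ℝ} (h0 : 0 < t) (h1 : t < 1 / 2) : rademacher 1 t = 1 := by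
  unfold rademacher
  refine Real.sign_of_pos (Real.sin_pos_of_pos_of_lt_pi ?_ ?_) <;> nlinarith [Real.pi_pos]

theorem rademacher_one_of_gt {t : ℝ} (h0 : 1 / 2 < t) (h1 : t < 1) : rademacher 1 t = -1 := by
  unfold rademacher
  refine Real.sign_of_neg ?_
  rw [← Real.sin_sub_two_pi]
  refine Real.sin_neg_of_neg_of_neg_pi_lt ?_ ?_ <;> nlinarith [Real.pi_pos]

theorem measurable_rademacher_sum {n : ℕ} (a : Fin n → ℝ) :
    Measurable fun t => ∑ j : Fin n, a j * rademacher (j + 1) t :=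
  Finset.measurable_sum _ fun _ _ => (measurable_rademacher _).const_mul _

theorem abs_rademacher_sum_le {n : ℕ} (a : Fin n → ℝ) (t : ℝ) :
    |∑ j : Fin n, a j * rademacher (j + 1) t| ≤ ∑ j, |a j| := by
  refine (abs_sum_le_sum_abs _ _).trans (sum_le_sum fun j _ => ?_)
  rw [abs_mul]
  exact mul_le_of_le_one_right (abs_nonneg _) (abs_rademacher_le _ _)

theorem intervalIntegrable_rademacher_sum {n : ℕ} (a : Fin n → ℝ) {G : ℝ → ℝ} (hG : Continuous G)
    (x y : ℝ) :
    IntervalIntegrable (fun t => G (∑ j : Fin n, a j * rademacher (j + 1) t)) volume x y := by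
  obtain ⟨C, hC⟩ := (isCompact_Icc (a := -∑ j, |a j|) (b := ∑ j, |a j|)).exists_bound_of_continuousOn
    hG.continuousOn
  rw [intervalIntegrable_iff, Set.uIoc]
  exact Integrable.of_bound (C := C)
    (hG.measurable.comp (measurable_rademacher_sum a)).aestronglyMeasurable
    (ae_of_all _ fun t => hC _ (abs_le.1 (abs_rademacher_sum_le a t)))

/-- Independence of the first sign from the others, in analytic form: `r_1` is constant on each open
half of `[0,1]`, and `t ↦ 2t` turns the remaining functions into the same sequence with its index
lowered by one, of period `1`. -/
theorem integral_rademacher_sum_succ {n : ℕ} (a : Fin (n + 1) → ℝ) {G : ℝ → ℝ}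
    (hG : Continuous G) :
    ∫ t in (0 : ℝ)..1, G (∑ j : Fin (n + 1), a j * rademacher (j + 1) t)
      = ∫ t in (0 : ℝ)..1, (G (a 0 + ∑ j : Fin n, a j.succ * rademacher (j + 1) t)
        + G (-a 0 + ∑ j : Fin n, a j.succ * rademacher (j + 1) t)) / 2 := by
  set S : ℝ → ℝ := fun t => ∑ j : Fin n, a j.succ * rademacher (j + 1) t with hS
  have hper : Function.Periodic S 1 := fun t => by
    simp only [hS, rademacher_add_one]
  have hsum : ∀ t, ∑ j : Fin (n + 1), a j * rademacher (j + 1) t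
      = a 0 * rademacher 1 t + S (2 * t) := fun t => by
    rw [Fin.sum_univ_succ, hS]
    simp only [Fin.val_zero, zero_add, Fin.val_succ]
    congr 1
    exact sum_congr rfl fun j _ => by rw [rademacher_succ]
  have hi : ∀ c, IntervalIntegrable (fun t => G (c + S t)) volume 0 1 := fun c =>
    intervalIntegrable_rademacher_sum (fun j => a j.succ) (G := fun x => G (c + x)) (by fun_prop) _ _
  have hint := intervalIntegrable_rademacher_sum a hG
  rw [← intervalIntegral.integral_add_adjacent_intervals (hint 0 (1 / 2)) (hint (1 / 2) 1)]
  have e1 : ∫ t in (0 : ℝ)..(1 / 2), G (∑ j : Fin (n + 1), a j * rademacher (j + 1) t)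
      = ∫ t in (0 : ℝ)..(1 / 2), (fun u => G (a 0 + S u)) (2 * t) := by
    refine intervalIntegral.integral_congr_Ioo_of_le (by norm_num) fun t ht => ?_
    rw [hsum, rademacher_one_of_lt ht.1 ht.2, mul_one]
  have e2 : ∫ t in (1 / 2 : ℝ)..1, G (∑ j : Fin (n + 1), a j * rademacher (j + 1) t)
      = ∫ t in (1 / 2 : ℝ)..1, (fun u => G (-a 0 + S u)) (2 * t) := by
    refine intervalIntegral.integral_congr_Ioo_of_le (by norm_num) fun t ht => ?_
    rw [hsum, rademacher_one_of_gt ht.1 ht.2, mul_neg_one]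
  have hper2 : Function.Periodic (fun u => G (-a 0 + S u)) 1 := fun t => by
    simp only [hper t]
  have e3 := hper2.intervalIntegral_add_eq 1 0
  rw [e1, e2, intervalIntegral.integral_comp_mul_left (fun u => G (a 0 + S u)) two_ne_zero,
    intervalIntegral.integral_comp_mul_left (fun u => G (-a 0 + S u)) two_ne_zero, intervalIntegral.integral_div,
    intervalIntegral.integral_add (hi _) (hi _)]
  norm_num at e3 ⊢
  rw [e3]
  ring

theorem integral_rademacher_sum_sq {n : ℕ} (a : Fin n → ℝ) :
    ∫ t in (0 : ℝ)..1, (∑ j : Fin n, a j * rademacher (j + 1) t) ^ 2 = ∑ j, a j ^ 2 := by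
  induction n with
  | zero => simp
  | succ n ih =>
    rw [integral_rademacher_sum_succ a (continuous_pow 2), Fin.sum_univ_succ,
      ← ih fun j => a j.succ]
    have hi := intervalIntegrable_rademacher_sum (fun j => a j.succ) (continuous_pow 2) 0 1
    calc _ = ∫ t in (0 : ℝ)..1, (a 0 ^ 2
          + (∑ j : Fin n, a j.succ * rademacher (j + 1) t) ^ 2) := by
          congr 1; ext t; ring
      _ = _ := by rw [intervalIntegral.integral_add (by simp) hi]; simp

theorem integral_rademacher_sum_pow_four_le {n : ℕ} (a : Fin n → ℝ) :
    ∫ t in (0 : ℝ)..1, (∑ j : Fin n, a j * rademacher (j + 1) t) ^ 4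
      ≤ 3 * (∑ j, a j ^ 2) ^ 2 := by
  induction n with
  | zero => simp
  | succ n ih =>
    rw [integral_rademacher_sum_succ a (continuous_pow 4), Fin.sum_univ_succ]
    have hi := intervalIntegrable_rademacher_sum (fun j => a j.succ) (continuous_pow 2) 0 1
    have hi4 := intervalIntegrable_rademacher_sum (fun j => a j.succ) (continuous_pow 4) 0 1
    have e : ∫ t in (0 : ℝ)..1, ((a 0 + ∑ j : Fin n, a j.succ * rademacher (j + 1) t) ^ 4
        + (-a 0 + ∑ j : Fin n, a j.succ * rademacher (j + 1) t) ^ 4) / 2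
        = a 0 ^ 4 + 6 * a 0 ^ 2 * ∑ j : Fin n, a j.succ ^ 2
          + ∫ t in (0 : ℝ)..1, (∑ j : Fin n, a j.succ * rademacher (j + 1) t) ^ 4 := by
      rw [← integral_rademacher_sum_sq]
      calc _ = ∫ t in (0 : ℝ)..1, (a 0 ^ 4
            + 6 * a 0 ^ 2 * (∑ j : Fin n, a j.succ * rademacher (j + 1) t) ^ 2
            + (∑ j : Fin n, a j.succ * rademacher (j + 1) t) ^ 4) := by
            congr 1; ext t; ring
        _ = _ := by
            rw [intervalIntegral.integral_add
              (IntervalIntegrable.add (by simp) (hi.const_mul _)) hi4,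
              intervalIntegral.integral_add (by simp) (hi.const_mul _),
              intervalIntegral.integral_const_mul]
            simp
    rw [e]
    have := ih fun j => a j.succ
    -- With `s` the sum of the remaining squares, this is `a₀⁴ + 6a₀²s + 3s² ≤ 3(a₀² + s)²`.
    nlinarith [sq_nonneg (a 0 ^ 2)]

theorem isRealKhinchineConstant_one_div_twelve {q : ℝ} (hq1 : 1 ≤ q) (hq2 : q ≤ 2) :
    IsRealKhinchineConstant q (1 / 12) := by
  refine ⟨by norm_num, fun n a => ?_⟩
  rw [intervalIntegral.integral_of_le zero_le_one]
  refine sqrt_le_of_moments (measurable_rademacher_sum a).abs (fun t => abs_nonneg _)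
    (abs_rademacher_sum_le a) hq1 hq2 (sum_nonneg fun j _ => sq_nonneg _) ?_ ?_
  · simp only [sq_abs]
    rw [← intervalIntegral.integral_of_le zero_le_one, integral_rademacher_sum_sq]
  · simp only [sq_abs, (show Even 4 by decide).pow_abs]
    rw [← intervalIntegral.integral_of_le zero_le_one]
    exact integral_rademacher_sum_pow_four_le a

/-! ### Moments of Steinhaus sums. -/

theorem integral_Icc_cons {n : ℕ} {F : (Fin (n + 1) → ℝ) → ℝ} (hF : Continuous F) :
    ∫ t in Set.Icc (0 : Fin (n + 1) → ℝ) 1, F t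
      = ∫ s in Set.Icc (0 : ℝ) 1, ∫ t in Set.Icc (0 : Fin n → ℝ) 1, F (Fin.cons s t) := by
  set e : ℝ × (Fin n → ℝ) ≃ᵐ (Fin (n + 1) → ℝ) :=
    (MeasurableEquiv.piFinSuccAbove (fun _ => ℝ) 0).symm with he
  have hem : MeasurePreserving e :=
    (volume_preserving_piFinSuccAbove (fun _ : Fin (n + 1) => ℝ) 0).symm _
  have hpre : e ⁻¹' Set.Icc 0 1 = Set.Icc (0 : ℝ) 1 ×ˢ Set.Icc (0 : Fin n → ℝ) 1 :=
    ((Fin.insertNthOrderIso (fun _ => ℝ) 0).preimage_Icc _ _).trans (Set.Icc_prod_eq _ _)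
  have hint : IntegrableOn F (Set.Icc 0 1) := hF.continuousOn.integrableOn_compact isCompact_Icc
  have hint2 := hint
  rw [← hem.integrableOn_comp_preimage e.measurableEmbedding, hpre] at hint2
  rw [← hem.setIntegral_preimage_emb e.measurableEmbedding, hpre, Measure.volume_eq_prod,
    setIntegral_prod]
  · refine setIntegral_congr_fun measurableSet_Icc fun s _ => ?_
    refine setIntegral_congr_fun measurableSet_Icc fun t _ => ?_
    simp only [he]
    congr 1
    exact Fin.insertNth_zero' s t
  · exact hint2

instance isProbabilityMeasure_restrict_unit_cube (n : ℕ) :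
    IsProbabilityMeasure (volume.restrict (Set.Icc (0 : Fin n → ℝ) 1)) :=
  ⟨by simp [Real.volume_Icc_pi]⟩

/-- The Steinhaus sum `∑ a_j exp (2 π i t_j)`. -/
noncomputable def steinhausSum {n : ℕ} (a : Fin n → ℂ) (t : Fin n → ℝ) : ℂ :=
  ∑ j : Fin n, a j * Complex.exp (2 * Real.pi * Complex.I * (t j : ℂ))

theorem continuous_steinhausSum {n : ℕ} (a : Fin n → ℂ) : Continuous (steinhausSum a) := by
  unfold steinhausSum
  fun_prop

theorem norm_exp_two_pi_I_mul (s : ℝ) :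
    ‖Complex.exp (2 * Real.pi * Complex.I * (s : ℂ))‖ = 1 := by
  rw [show (2 * Real.pi * Complex.I * (s : ℂ)) = ((2 * Real.pi * s : ℝ) : ℂ) * Complex.I by
    push_cast; ring]
  exact Complex.norm_exp_ofReal_mul_I _

theorem norm_steinhausSum_le {n : ℕ} (a : Fin n → ℂ) (t : Fin n → ℝ) :
    ‖steinhausSum a t‖ ≤ ∑ j, ‖a j‖ := by
  refine (norm_sum_le _ _).trans (le_of_eq (sum_congr rfl fun j _ => ?_))
  rw [norm_mul, norm_exp_two_pi_I_mul, mul_one]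

theorem steinhausSum_cons {n : ℕ} (a : Fin (n + 1) → ℂ) (s : ℝ) (t : Fin n → ℝ) :
    steinhausSum a (Fin.cons s t) = a 0 * Complex.exp (2 * Real.pi * Complex.I * (s : ℂ))
      + steinhausSum (fun j => a j.succ) t := by
  simp [steinhausSum, Fin.sum_univ_succ]

theorem exp_two_pi_I_mul_add_half (s : ℝ) :
    Complex.exp (2 * Real.pi * Complex.I * ((s + 1 / 2 : ℝ) : ℂ))
      = -Complex.exp (2 * Real.pi * Complex.I * (s : ℂ)) := by
  rw [← Complex.exp_add_pi_mul_I]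
  congr 1
  push_cast
  ring

theorem integrableOn_steinhausSum {n : ℕ} (a : Fin n → ℂ) {G : ℂ → ℝ} (hG : Continuous G) :
    IntegrableOn (fun t => G (steinhausSum a t)) (Set.Icc 0 1) :=
  (hG.comp (continuous_steinhausSum a)).continuousOn.integrableOn_compact isCompact_Icc

/-- Only the symmetry of one Steinhaus variable is used: the shift `s ↦ s + 1/2` changes its sign
and preserves the integral over a period, so `G` may be averaged over `±w`. -/
theorem integral_steinhausSum_succ_le {n : ℕ} (a : Fin (n + 1) → ℂ) {G H : ℂ → ℝ}
    (hG : Continuous G) (hH : Continuous H)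
    (h : ∀ w z : ℂ, ‖w‖ = ‖a 0‖ → (G (w + z) + G (-w + z)) / 2 ≤ H z) :
    ∫ t in Set.Icc (0 : Fin (n + 1) → ℝ) 1, G (steinhausSum a t)
      ≤ ∫ t in Set.Icc (0 : Fin n → ℝ) 1, H (steinhausSum (fun j => a j.succ) t) := by
  set S := steinhausSum (fun j => a j.succ) with hS
  have hSc : Continuous S := continuous_steinhausSum _
  set w : ℝ → ℂ := fun s => a 0 * Complex.exp (2 * Real.pi * Complex.I * (s : ℂ)) with hw
  have hwc : Continuous w := by fun_prop
  have hw2 : ∀ s, w (s + 1 / 2) = -w s := fun s => by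
    simp only [hw, exp_two_pi_I_mul_add_half, mul_neg]
  set Φ : ℝ → ℝ := fun s => ∫ t in Set.Icc (0 : Fin n → ℝ) 1, G (w s + S t) with hΦ
  have hΦc : Continuous Φ := by
    refine continuous_parametric_integral_of_continuous ?_ isCompact_Icc
    fun_prop
  have hper : Function.Periodic Φ 1 := fun s => by
    have : w (s + 1) = w s := by
      rw [show s + 1 = s + 1 / 2 + 1 / 2 by ring, hw2, hw2, neg_neg]
    simp only [hΦ, this]
  have hpair : ∀ s, Φ s + Φ (s + 1 / 2) ≤ 2 * ∫ t in Set.Icc (0 : Fin n → ℝ) 1, H (S t) := fun s => by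
    have i1 : IntegrableOn (fun t => G (w s + S t)) (Set.Icc 0 1) :=
      integrableOn_steinhausSum (fun j => a j.succ) (G := fun z => G (w s + z)) (by fun_prop)
    have i2 : IntegrableOn (fun t => G (-w s + S t)) (Set.Icc 0 1) :=
      integrableOn_steinhausSum (fun j => a j.succ) (G := fun z => G (-w s + z)) (by fun_prop)
    simp only [hΦ, hw2]
    rw [← integral_add i1 i2, ← integral_const_mul]
    refine integral_mono (i1.add i2) ((integrableOn_steinhausSum _ hH).const_mul 2) fun t => ?_
    have := h (w s) (S t) (by simp only [hw, norm_mul, norm_exp_two_pi_I_mul, mul_one])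
    dsimp only
    linarith
  have hhalf : ∫ s in (0 : ℝ)..1, Φ (s + 1 / 2) = ∫ s in (0 : ℝ)..1, Φ s := by
    rw [intervalIntegral.integral_comp_add_right Φ (1 / 2)]
    have := hper.intervalIntegral_add_eq (1 / 2) 0
    rw [zero_add] at this
    rw [zero_add, add_comm (1 : ℝ), this]
  have hle : ∫ s in (0 : ℝ)..1, (Φ s + Φ (s + 1 / 2))
      ≤ ∫ _ in (0 : ℝ)..1, 2 * ∫ t in Set.Icc (0 : Fin n → ℝ) 1, H (S t) := by
    refine intervalIntegral.integral_mono_on zero_le_one ?_ (by simp) fun s _ => hpair s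
    exact Continuous.intervalIntegrable (by fun_prop) _ _
  rw [intervalIntegral.integral_add (hΦc.intervalIntegrable _ _)
    (Continuous.intervalIntegrable (by fun_prop) _ _), hhalf, intervalIntegral.integral_const] at hle
  rw [integral_Icc_cons (F := fun t => G (steinhausSum a t)) (hG.comp (continuous_steinhausSum a)), integral_Icc_eq_integral_Ioc,
    ← intervalIntegral.integral_of_le zero_le_one]
  have e : ∫ s in (0 : ℝ)..1, ∫ t in Set.Icc (0 : Fin n → ℝ) 1,
      G (steinhausSum a (Fin.cons s t)) = ∫ s in (0 : ℝ)..1, Φ s := by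
    simp only [steinhausSum_cons]
    rfl
  rw [e]
  simp only [sub_zero, one_smul] at hle
  linarith

theorem norm_add_sq_add_norm_neg_add_sq (w z : ℂ) :
    ‖w + z‖ ^ 2 + ‖-w + z‖ ^ 2 = 2 * (‖w‖ ^ 2 + ‖z‖ ^ 2) := by
  simp only [Complex.sq_norm, Complex.normSq_apply, Complex.add_re, Complex.add_im, Complex.neg_re,
    Complex.neg_im]
  ring

/-- The left side is `(|w|² + |z|²)² + 4 (Re w z̄)²`, and the defect in `(Re w z̄)² ≤ |w|²|z|²` is
`(Im w z̄)²`. -/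
theorem norm_add_pow_four_add_norm_neg_add_pow_four_le (w z : ℂ) :
    (‖w + z‖ ^ 4 + ‖-w + z‖ ^ 4) / 2 ≤ ‖w‖ ^ 4 + 6 * ‖w‖ ^ 2 * ‖z‖ ^ 2 + ‖z‖ ^ 4 := by
  simp only [show (4 : ℕ) = 2 * 2 from rfl, pow_mul]
  simp only [Complex.sq_norm, Complex.normSq_apply, Complex.add_re, Complex.add_im, Complex.neg_re,
    Complex.neg_im]
  nlinarith [sq_nonneg (w.re * z.im - w.im * z.re)]

theorem integral_norm_steinhausSum_sq {n : ℕ} (a : Fin n → ℂ) :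
    ∫ t in Set.Icc (0 : Fin n → ℝ) 1, ‖steinhausSum a t‖ ^ 2 = ∑ j, ‖a j‖ ^ 2 := by
  induction n with
  | zero => simp [steinhausSum]
  | succ n ih =>
    have hi := integrableOn_steinhausSum (fun j => a j.succ) (G := fun z => ‖z‖ ^ 2) (by fun_prop)
    have e : ∫ t in Set.Icc (0 : Fin n → ℝ) 1,
        (‖a 0‖ ^ 2 + ‖steinhausSum (fun j => a j.succ) t‖ ^ 2) = ∑ j, ‖a j‖ ^ 2 := by
      rw [integral_add (integrable_const _) hi, ih, Fin.sum_univ_succ]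
      simp
    rw [← e]
    refine le_antisymm ?_ ?_
    · refine integral_steinhausSum_succ_le a (G := fun z => ‖z‖ ^ 2)
        (H := fun z => ‖a 0‖ ^ 2 + ‖z‖ ^ 2) (by fun_prop) (by fun_prop) fun w z hw => ?_
      rw [← hw]
      linarith [norm_add_sq_add_norm_neg_add_sq w z]
    -- The parallelogram law is an equality, so the one-sided lemma also applies to the negated
    -- functions.
    · rw [← neg_le_neg_iff, ← integral_neg, ← integral_neg]
      refine integral_steinhausSum_succ_le a (G := fun z => -‖z‖ ^ 2)
        (H := fun z => -(‖a 0‖ ^ 2 + ‖z‖ ^ 2)) (by fun_prop) (by fun_prop) fun w z hw => ?_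
      rw [← hw]
      linarith [norm_add_sq_add_norm_neg_add_sq w z]

theorem integral_norm_steinhausSum_pow_four_le {n : ℕ} (a : Fin n → ℂ) :
    ∫ t in Set.Icc (0 : Fin n → ℝ) 1, ‖steinhausSum a t‖ ^ 4 ≤ 3 * (∑ j, ‖a j‖ ^ 2) ^ 2 := by
  induction n with
  | zero => simp [steinhausSum]
  | succ n ih =>
    have hi := integrableOn_steinhausSum (fun j => a j.succ) (G := fun z => ‖z‖ ^ 2) (by fun_prop)
    have hi4 := integrableOn_steinhausSum (fun j => a j.succ) (G := fun z => ‖z‖ ^ 4) (by fun_prop)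
    refine (integral_steinhausSum_succ_le a (G := fun z => ‖z‖ ^ 4)
      (H := fun z => ‖a 0‖ ^ 4 + 6 * ‖a 0‖ ^ 2 * ‖z‖ ^ 2 + ‖z‖ ^ 4) (by fun_prop) (by fun_prop)
      fun w z hw => ?_).trans ?_
    · rw [← hw]
      exact norm_add_pow_four_add_norm_neg_add_pow_four_le w z
    · have hc : IntegrableOn (fun t => ‖a 0‖ ^ 4
          + 6 * ‖a 0‖ ^ 2 * ‖steinhausSum (fun j => a j.succ) t‖ ^ 2) (Set.Icc 0 1) :=
        (integrable_const _).add (hi.const_mul _)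
      rw [integral_add hc hi4,
        integral_add (integrable_const _) (hi.const_mul _), integral_const_mul,
        integral_norm_steinhausSum_sq, Fin.sum_univ_succ, integral_const, probReal_univ, one_smul]
      have := ih fun j => a j.succ
      nlinarith [sq_nonneg (‖a 0‖ ^ 2)]

theorem isComplexKhinchineConstant_one_div_twelve {q : ℝ} (hq1 : 1 ≤ q) (hq2 : q ≤ 2) :
    IsComplexKhinchineConstant q (1 / 12) :=
  ⟨by norm_num, fun n a => sqrt_le_of_moments (continuous_steinhausSum a).norm.measurable
    (fun _ => norm_nonneg _) (norm_steinhausSum_le a) hq1 hq2 (sum_nonneg fun j _ => sq_nonneg _)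
    (integral_norm_steinhausSum_sq a) (integral_norm_steinhausSum_pow_four_le a)⟩

/-! ### The best Khinchine constants are admissible and at most one. -/

theorem rpow_integral_rpow_le_one {Ω : Type*} [MeasurableSpace Ω] (μ : Measure Ω)
    [IsProbabilityMeasure μ] {f : Ω → ℝ} (hf0 : ∀ ω, 0 ≤ f ω) (hf1 : ∀ ω, f ω ≤ 1) {q : ℝ}
    (hq : 0 < q) : (∫ ω, f ω ^ q ∂μ) ^ (1 / q) ≤ 1 := by
  have h0 : 0 ≤ ∫ ω, f ω ^ q ∂μ := integral_nonneg fun ω => Real.rpow_nonneg (hf0 ω) _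
  refine Real.rpow_le_one h0 ?_ (by positivity)
  calc ∫ ω, f ω ^ q ∂μ ≤ ∫ _, (1 : ℝ) ∂μ :=
        integral_mono_of_nonneg (ae_of_all _ fun ω => Real.rpow_nonneg (hf0 ω) _)
          (integrable_const _) (ae_of_all _ fun ω => Real.rpow_le_one (hf0 ω) (hf1 ω) hq.le)
    _ = 1 := by simp

instance isProbabilityMeasure_restrict_Ioc_zero_one :
    IsProbabilityMeasure (volume.restrict (Set.Ioc (0 : ℝ) 1)) := ⟨by simp⟩

theorem IsRealKhinchineConstant.le_one {q A : ℝ} (hq : 0 < q) (h : IsRealKhinchineConstant q A) :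
    A ≤ 1 := by
  have h1 := h.2 1 1
  rw [intervalIntegral.integral_of_le zero_le_one] at h1
  have h2 := rpow_integral_rpow_le_one (volume.restrict (Set.Ioc (0 : ℝ) 1))
    (f := fun t => |∑ j : Fin 1, (1 : Fin 1 → ℝ) j * rademacher (j + 1) t|)
    (fun t => abs_nonneg _) (fun t => by simpa using abs_rademacher_le 1 t) hq
  simpa using h1.trans h2

theorem IsComplexKhinchineConstant.le_one {q A : ℝ} (hq : 0 < q)
    (h : IsComplexKhinchineConstant q A) : A ≤ 1 := by
  have h1 := h.2 1 1
  have h2 := rpow_integral_rpow_le_one (volume.restrict (Set.Icc (0 : Fin 1 → ℝ) 1))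
    (f := fun t => ‖steinhausSum (1 : Fin 1 → ℂ) t‖)
    (fun t => norm_nonneg _) (fun t => by simpa using norm_steinhausSum_le (1 : Fin 1 → ℂ) t) hq
  simpa using h1.trans h2

/-- Khinchine's inequality is linear in the constant, so it passes to the supremum of the admissible
constants. -/
theorem csSup_mul_le {s : Set ℝ} (hs : s.Nonempty) {x y : ℝ} (hx : 0 ≤ x)
    (h : ∀ A ∈ s, A * x ≤ y) : sSup s * x ≤ y := by
  rcases hx.eq_or_lt with rfl | hx
  · obtain ⟨A, hA⟩ := hs
    simpa using h A hA
  · rw [← le_div_iff₀ hx]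
    exact csSup_le hs fun A hA => (le_div_iff₀ hx).2 (h A hA)

/-- The constant `1/12` makes the set nonempty and its supremum positive; the bound by `1` makes
`sSup` a genuine supremum rather than its default value `0`. -/
theorem isRealKhinchineConstant_realKhinchine {q : ℝ} (hq1 : 1 ≤ q) (hq2 : q ≤ 2) :
    IsRealKhinchineConstant q (realKhinchine q) := by
  have hne := isRealKhinchineConstant_one_div_twelve hq1 hq2
  refine ⟨?_, fun n a => csSup_mul_le ⟨_, hne⟩ (by positivity) fun A hA => hA.2 n a⟩
  exact hne.1.trans_le (le_csSup ⟨1, fun A hA => hA.le_one (by linarith)⟩ hne)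

theorem isComplexKhinchineConstant_complexKhinchine {q : ℝ} (hq1 : 1 ≤ q) (hq2 : q ≤ 2) :
    IsComplexKhinchineConstant q (complexKhinchine q) := by
  have hne := isComplexKhinchineConstant_one_div_twelve hq1 hq2
  refine ⟨?_, fun n a => csSup_mul_le ⟨_, hne⟩ (by positivity) fun A hA => hA.2 n a⟩
  exact hne.1.trans_le (le_csSup ⟨1, fun A hA => hA.le_one (by linarith)⟩ hne)

theorem IsRealKhinchineConstant.hasKhinchine {q A : ℝ} (h : IsRealKhinchineConstant q A) :
    HasKhinchine ℝ q A := by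
  refine ⟨h.1, fun n => ⟨ℝ, inferInstance, volume.restrict (Set.Ioc 0 1),
    fun j t => rademacher (j + 1) t, inferInstance, fun j => measurable_rademacher _,
    fun j t => abs_rademacher_le _ t, fun a => ?_⟩⟩
  have := h.2 n a
  rwa [intervalIntegral.integral_of_le zero_le_one] at this

theorem IsComplexKhinchineConstant.hasKhinchine {q A : ℝ} (h : IsComplexKhinchineConstant q A) :
    HasKhinchine ℂ q A := by
  refine ⟨h.1, fun n => ⟨Fin n → ℝ, inferInstance, volume.restrict (Set.Icc 0 1),
    fun j t => Complex.exp (2 * Real.pi * Complex.I * (t j : ℂ)), inferInstance, fun j => ?_,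
    fun j t => (norm_exp_two_pi_I_mul _).le, h.2 n⟩⟩
  exact Continuous.measurable (by fun_prop)

/-! ### From the bound on the largest exponent to the theorem. -/

theorem bhConstant_le_prod_khinchine {𝕜 : Type} [RCLike 𝕜] (K : ℝ → ℝ)
    (hK : ∀ p, 1 ≤ p → p < 2 → HasKhinchine 𝕜 p (K p)) (hK1 : ∀ p, 1 ≤ p → p < 2 → K p ≤ 1)
    (m : ℕ) (hm : 2 ≤ m) (q : Fin m → ℝ) (hq : ∀ i, q i ∈ Set.Icc (1 : ℝ) 2)
    (hsum : ∑ i, 1 / q i = ((m : ℝ) + 1) / 2)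
    (hmax : ∀ i, q i < (2 * (m : ℝ) ^ 2 - 4 * m + 2) / ((m : ℝ) ^ 2 - m - 1)) :
    IsBHConstant 𝕜 q (∏ j ∈ Finset.Icc 2 m, (K ((2 * (j : ℝ) - 2) / j))⁻¹) ∧
      bhConstant 𝕜 q ≤ ∏ j ∈ Finset.Icc 2 m, (K ((2 * (j : ℝ) - 2) / j))⁻¹ := by
  suffices h : IsBHConstant 𝕜 q (∏ j ∈ Finset.Icc 2 m, (K ((2 * (j : ℝ) - 2) / j))⁻¹) from
    ⟨h, csInf_le ⟨1, fun C hC => hC.1⟩ h⟩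
  refine ⟨?_, fun n _ T => ?_⟩
  -- Admissibility includes `1 ≤ C`, which is why `K p ≤ 1` is needed.
  · refine Finset.one_le_prod fun j hj => ?_
    have hj2 : (2 : ℝ) ≤ j := by exact_mod_cast (mem_Icc.1 hj).1
    have h1 : 1 ≤ (2 * (j : ℝ) - 2) / j := by rw [le_div_iff₀ (by linarith)]; linarith
    have h2 : (2 * (j : ℝ) - 2) / j < 2 := by rw [div_lt_iff₀ (by linarith)]; linarith
    exact (one_le_inv₀ (hK _ h1 h2).1).2 (hK1 _ h1 h2)
  · obtain ⟨m, rfl⟩ : ∃ k, m = k + 1 := ⟨m - 1, by omega⟩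
    have hm1 : (1 : ℝ) ≤ m := by exact_mod_cast (by omega : 1 ≤ m)
    push_cast at hsum hmax
    have hq0 : ∀ i, 0 < q i := fun i => by linarith [(hq i).1]
    have hD : 0 < ((m : ℝ) + 1) ^ 2 - (m + 1) - 1 := by nlinarith
    have hinv : ∀ i, (((m : ℝ) + 1) ^ 2 - (m + 1) - 1) / (2 * m ^ 2) < 1 / q i := fun i => by
      have h1 := hmax i
      rw [lt_div_iff₀ hD] at h1
      rw [div_lt_div_iff₀ (by positivity) (hq0 i)]
      nlinarith
    refine mixedNorm_le_prod_khinchine K hK m q (fun i => ?_) (by rw [hsum]; ring) n T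
    have hsplit := Fin.sum_univ_succAbove (fun i => 1 / q i) i
    -- The upper bound on the other `m` exponents bounds their reciprocals below; subtracting from
    -- the prescribed sum leaves `1 / q i < (m+1)/(2m)`, that is, `q i > 2m/(m+1)`.
    have hothers : (m : ℝ) * ((((m : ℝ) + 1) ^ 2 - (m + 1) - 1) / (2 * m ^ 2))
        < ∑ l : Fin m, 1 / q (i.succAbove l) := by
      have hne : (univ : Finset (Fin m)).Nonempty := ⟨⟨0, by omega⟩, mem_univ _⟩
      refine lt_of_eq_of_lt ?_ (sum_lt_sum_of_nonempty hne fun l _ => hinv (i.succAbove l))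
      simp
    have hi : 1 / q i < (m + 1) / (2 * m) := by
      have e : ((m : ℝ) + 1) / (2 * m)
          = (m + 1 + 1) / 2 - m * ((((m : ℝ) + 1) ^ 2 - (m + 1) - 1) / (2 * m ^ 2)) := by
        field_simp
        ring
      rw [e]
      linarith
    rw [div_lt_div_iff₀ (hq0 i) (by positivity)] at hi
    rw [div_lt_iff₀ (by positivity)]
    linarith
theorem theorem2p3 (m : ℕ) (hm : 2 ≤ m) (q : Fin m → ℝ)
    (hq : ∀ i, q i ∈ Set.Icc (1 : ℝ) 2)
    (hsum : ∑ i, 1 / q i = ((m : ℝ) + 1) / 2)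
    (hmax : ∀ i, q i < (2 * (m : ℝ) ^ 2 - 4 * m + 2) / ((m : ℝ) ^ 2 - m - 1)) :
    (IsBHConstant ℝ q (∏ j ∈ Finset.Icc 2 m, (realKhinchine ((2 * (j : ℝ) - 2) / j))⁻¹) ∧
      bhConstant ℝ q ≤ ∏ j ∈ Finset.Icc 2 m, (realKhinchine ((2 * (j : ℝ) - 2) / j))⁻¹) ∧
    (IsBHConstant ℂ q (∏ j ∈ Finset.Icc 2 m, (complexKhinchine ((2 * (j : ℝ) - 2) / j))⁻¹) ∧
      bhConstant ℂ q ≤ ∏ j ∈ Finset.Icc 2 m, (complexKhinchine ((2 * (j : ℝ) - 2) / j))⁻¹) := by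
  exact ⟨bhConstant_le_prod_khinchine realKhinchine
      (fun p h1 h2 => (isRealKhinchineConstant_realKhinchine h1 h2.le).hasKhinchine)
      (fun p h1 h2 => (isRealKhinchineConstant_realKhinchine h1 h2.le).le_one (by linarith))
      m hm q hq hsum hmax,
    bhConstant_le_prod_khinchine complexKhinchine
      (fun p h1 h2 => (isComplexKhinchineConstant_complexKhinchine h1 h2.le).hasKhinchine)
      (fun p h1 h2 => (isComplexKhinchineConstant_complexKhinchine h1 h2.le).le_one (by linarith))
      m hm q hq hsum hmax⟩
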